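/- Let $N\ge 2$ and let $X=\{\lambda_1,\dots,\lambda_N\}\subset\mathbb C$ be the set of vertices (extreme points) of a convex polygon $P\subset\mathbb C$, so that $P$ is the convex hull of $X$ (a line segment when $N=2$). Put $f(z)=\prod_{k=1}^N(z-\lambda_k)$, and let $\operatorname{Lim}^1(X)$ be the set of all bounded complex sequences $a=(a_n)_{n\ge1}$ with $\sum_n \operatorname{dist}(a_n,X)<\infty$. Let $$K_X=\Big\{\sum_{k=1}^N\nu_k\lambda_k:\ \nu_1,\dots,\nu_N\in\mathbb Z,\ \sum_{k=1}^N\nu_k=0\Big\},\qquad \Gamma_X=\mathbb C/K_X .$$ For $a\in\operatorname{Lim}^1(X)$ the renormalized sum $s(a)\in\Gamma_X$ is the coset $\sum_n(a_n-x_n)+K_X$, where $(x_n)$ is any sequence of points of $X$ with $\sum_n|a_n-x_n|<\infty$ (such sequences exist, and the coset does not depend on the choice). Let $d=(d_n)_{n\ge1}$ be a sequence of complex numbers with $d_n\in P$ for all $n$ and $\sum_n|f(d_n)|<\infty$. Then $d\in\operatorname{Lim}^1(X)$. Moreover, if there are a complex Hilbert space $H$ with an orthonormal basis $e_1,e_2,\dots$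 and a bounded normal operator $A$ on $H$ with spectrum and essential spectrum $\sigma(A)=\sigma_e(A)=X$ (where $\sigma_e(A)$ is the set of $\lambda\in\mathbb C$ for which $A-\lambda$ is not Fredholm) such that $d_n=\langle Ae_n,e_n\rangle$ for all $n\ge1$, then $s(d)=0$ in $\Gamma_X$. -/

import Mathlib

/-- `P` is a (solid) convex polygon in the complex plane, with set of vertices `X`: it is the convex
hull of the finite set `X`, every point of `X` is a corner of it, and there are at least two
vertices (two vertices give a line segment). -/
structure IsConvexPolygon (P : Set ℂ) (X : Finset ℂ) : Prop where
  two_le_card : 2 ≤ X.card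
  eq_convexHull : P = convexHull ℝ (X : Set ℂ)
  extremePoints_eq : P.extremePoints ℝ = (X : Set ℂ)

theorem IsConvexPolygon.nonempty {P : Set ℂ} {X : Finset ℂ} (h : IsConvexPolygon P X) :
    X.Nonempty :=
  Finset.card_pos.mp (lt_of_lt_of_le two_pos h.two_le_card)

/-- The set `Lim¹(X)` of the bounded sequences `a` with `∑ dist(a n, X) < ∞`
(used for nonempty `X`). -/
def LimOne (X : Finset ℂ) : Set (ℕ → ℂ) :=
  {a | Bornology.IsBounded (Set.range a) ∧
    Summable fun n => Metric.infDist (a n) (X : Set ℂ)}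

/-- The subgroup `K_X` of `ℂ`: all combinations `∑ ν_k λ_k` of the points `λ_k` of `X` with integer
coefficients whose sum is zero. -/
def obstructionSubgroup (X : Finset ℂ) : AddSubgroup ℂ where
  carrier := {z | ∃ ν : ℂ → ℤ, ∑ l ∈ X, ν l = 0 ∧ z = ∑ l ∈ X, (ν l : ℂ) * l}
  zero_mem' := ⟨0, by simp, by simp⟩
  add_mem' := by
    rintro _ _ ⟨ν, hν, rfl⟩ ⟨μ, hμ, rfl⟩
    refine ⟨ν + μ, ?_, ?_⟩
    · simp [Finset.sum_add_distrib, hν, hμ]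
    · simp [Finset.sum_add_distrib, add_mul]
  neg_mem' := by
    rintro _ ⟨ν, hν, rfl⟩
    refine ⟨-ν, ?_, ?_⟩
    · simp [hν]
    · simp

/-- The obstruction group `Γ_X = ℂ / K_X`. -/
abbrev ObstructionGroup (X : Finset ℂ) : Type := ℂ ⧸ obstructionSubgroup X

/-- `x` is a sequence of points of `X` with `∑ |a n - x n| < ∞`. -/
def IsApproximant (X : Finset ℂ) (a x : ℕ → ℂ) : Prop :=
  (∀ n, x n ∈ X) ∧ Summable fun n => ‖a n - x n‖

theorem LimOne.exists_isApproximant {X : Finset ℂ} (hX : X.Nonempty) (a : LimOne X) :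
    ∃ x, IsApproximant X a x := by
  have h (n : ℕ) : ∃ x ∈ (X : Set ℂ), Metric.infDist (a.1 n) (X : Set ℂ) = dist (a.1 n) x :=
    X.finite_toSet.isCompact.exists_infDist_eq_dist hX _
  choose x hx hd using h
  refine ⟨x, hx, ?_⟩
  have := a.2.2
  simpa only [hd, dist_eq_norm] using this

/-- The renormalized sum `s(a) ∈ Γ_X` of `a ∈ Lim¹(X)`: the coset of `∑ (a n - x n)`, for a choice
of a sequence `x` in `X` with `∑ |a n - x n| < ∞`. -/
noncomputable def renormalizedSum (X : Finset ℂ) (hX : X.Nonempty) (a : LimOne X) :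
    ObstructionGroup X :=
  QuotientAddGroup.mk
    (∑' n, (a.1 n - Classical.choose (LimOne.exists_isApproximant hX a) n))

theorem tsum_sub_mem_obstructionSubgroup {X : Finset ℂ} {a x y : ℕ → ℂ}
    (hx : IsApproximant X a x) (hy : IsApproximant X a y) :
    ∑' n, (x n - y n) ∈ obstructionSubgroup X := by
  classical
  have hs : Summable fun n => x n - y n := by
    simpa using hy.2.of_norm.sub hx.2.of_norm
  have hgen (n : ℕ) : x n - y n ∈ obstructionSubgroup X := by
    refine ⟨fun l => (if l = x n then 1 else 0) - (if l = y n then 1 else 0), ?_, ?_⟩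
    · simp [hx.1 n, hy.1 n]
    · simp [sub_mul, hx.1 n, hy.1 n]
  have hfin : {n | x n - y n ≠ 0}.Finite := by
    have hev : ∀ᶠ n in Filter.cofinite, x n - y n ∉
        (((X ×ˢ X).image fun p => p.1 - p.2).erase 0 : Finset ℂ) :=
      hs.tendsto_cofinite_zero.eventually
        ((Finset.isClosed _).isOpen_compl.eventually_mem (by simp))
    refine hev.subset fun n hn h => h ?_
    exact Finset.mem_erase.mpr
      ⟨hn, Finset.mem_image.mpr ⟨(x n, y n), Finset.mem_product.mpr ⟨hx.1 n, hy.1 n⟩, rfl⟩⟩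
  have : ∑' n, (x n - y n) = ∑ n ∈ hfin.toFinset, (x n - y n) :=
    tsum_eq_sum (by simp)
  rw [this]
  exact sum_mem fun n _ => hgen n

/-- The renormalized sum does not depend on the choice of the sequence `x`. -/
theorem renormalizedSum_eq {X : Finset ℂ} (hX : X.Nonempty) (a : LimOne X) {x : ℕ → ℂ}
    (hx : IsApproximant X a x) :
    renormalizedSum X hX a = QuotientAddGroup.mk (∑' n, (a.1 n - x n)) := by
  have hc := Classical.choose_spec (LimOne.exists_isApproximant hX a)
  refine QuotientAddGroup.eq.mpr ?_
  have := tsum_sub_mem_obstructionSubgroup hc hx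
  rwa [neg_add_eq_sub, ← hx.2.of_norm.tsum_sub hc.2.of_norm,
    tsum_congr fun n => sub_sub_sub_cancel_left _ _ _]

section Operators

variable {H : Type*} [NormedAddCommGroup H] [InnerProductSpace ℂ H] [CompleteSpace H]

/-- The essential spectrum of a bounded operator `A`: all `l` for which `A - l` is not Fredholm. -/
def essentialSpectrum (A : H →L[ℂ] H) : Set ℂ :=
  {l | ¬ (A - algebraMap ℂ (H →L[ℂ] H) l).IsFredholm}

/-- The set `𝒩(X)` of the normal operators with spectrum and essential spectrum equal to `X`. -/
def normalOperators (H : Type*) [NormedAddCommGroup H] [InnerProductSpace ℂ H] [CompleteSpace H]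
    (X : Finset ℂ) : Set (H →L[ℂ] H) :=
  {A | IsStarNormal A ∧ spectrum ℂ A = (X : Set ℂ) ∧ essentialSpectrum A = (X : Set ℂ)}

/-- The diagonal of `A` in the orthonormal basis `e`. Mathlib's inner product is linear in its second
argument. -/
noncomputable def diagonalSeq (e : HilbertBasis ℕ ℂ H) (A : H →L[ℂ] H) (n : ℕ) : ℂ :=
  inner ℂ (e n) (A (e n))

end Operators

/-! Membership in `LimOne` holds because |f(z)| dominates dist(z, X)
(`exists_infDist_le_mul_norm_prod_sub`). For the obstruction, write A = ∑ λ E_λ with spectral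
projections. The weights ‖E_λ e_n‖² express d_n as a convex combination of vertices, and since
vertices are extreme, the weight off x_n is O(|d_n - x_n|)
(`IsConvexPolygon.exists_one_sub_weight_le`). So the diagonal of E_λ differs summably from the
indicator of {n | x_n = λ}, the diagonal of a projection F. Then E_λ - F is Hilbert–Schmidt, and the
sum of the differences is an integer ν_λ (`HilbertBasis.exists_int_tsum_sub_tsum`): the dimension of
ker(E_λ - F - 1) minus that of ker(E_λ - F + 1). Summing over λ gives ∑ ν_λ = 0 and ∑ (d_n - x_n) =
∑ ν_λ λ. -/

open scoped InnerProductSpace ENNReal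

/-! ### Hilbert–Schmidt sums and compactness. -/

section HilbertSchmidt

variable {H : Type*} [NormedAddCommGroup H] [InnerProductSpace ℂ H]
variable {ι κ : Type*}

theorem HilbertBasis.tsum_enorm_inner_sq (b : HilbertBasis ι ℂ H) (x : H) :
    ∑' i, ‖⟪b i, x⟫_ℂ‖ₑ ^ 2 = ‖x‖ₑ ^ 2 := by
  have h : HasSum (fun i => ‖⟪b i, x⟫_ℂ‖ ^ 2) (‖x‖ ^ 2) := by
    have := Complex.hasSum_re (b.hasSum_inner_mul_inner x x)
    convert! this using 1
    · ext i
      rw [← inner_conj_symm x (b i), ← Complex.normSq_eq_conj_mul_self, Complex.ofReal_re,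
        Complex.normSq_eq_norm_sq]
    · exact (inner_self_eq_norm_sq (𝕜 := ℂ) x).symm
  have hn (y : ℂ) : ‖y‖ₑ ^ 2 = ENNReal.ofReal (‖y‖ ^ 2) := by
    rw [ENNReal.ofReal_pow (norm_nonneg _), ofReal_norm]
  simp_rw [hn]
  rw [← ENNReal.ofReal_tsum_of_nonneg (fun _ => by positivity) h.summable, h.tsum_eq,
    ENNReal.ofReal_pow (norm_nonneg _), ofReal_norm]

theorem ContinuousLinearMap.isCompactOperator_rankOne (x y : H) :
    IsCompactOperator (InnerProductSpace.rankOne ℂ x y) := by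
  have h : IsCompactOperator (id : ℂ → ℂ) :=
    (isCompactOperator_id_iff_finiteDimensional (𝕜 := ℂ)).mpr inferInstance
  exact (h.comp_clm (innerSL ℂ y)).clm_comp (ContinuousLinearMap.toSpanSingleton ℂ x)

variable [CompleteSpace H]

/-- The Hilbert–Schmidt norm of an operator equals that of its adjoint, and it can be computed in
any Hilbert basis. -/
theorem HilbertBasis.tsum_enorm_apply_sq_eq_adjoint (e : HilbertBasis ι ℂ H)
    (b : HilbertBasis κ ℂ H) (T : H →L[ℂ] H) :
    ∑' i, ‖T (e i)‖ₑ ^ 2 = ∑' j, ‖(star T) (b j)‖ₑ ^ 2 := by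
  simp_rw [← b.tsum_enorm_inner_sq (T _), ← e.tsum_enorm_inner_sq ((star T) _)]
  rw [ENNReal.tsum_comm]
  refine tsum_congr fun j => tsum_congr fun i => ?_
  rw [ContinuousLinearMap.star_eq_adjoint, ContinuousLinearMap.adjoint_inner_right,
    ← inner_conj_symm, RCLike.enorm_conj]

theorem HilbertBasis.enorm_sq_le_tsum (e : HilbertBasis ι ℂ H) (T : H →L[ℂ] H) :
    ‖T‖ₑ ^ 2 ≤ ∑' i, ‖T (e i)‖ₑ ^ 2 := by
  have hT : ‖T‖ₑ = ‖star T‖ₑ := by simp [enorm_eq_nnnorm]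
  rcases eq_or_ne (∑' i, ‖T (e i)‖ₑ ^ 2) ∞ with h | h
  · simp [h]
  set S := ∑' i, ‖T (e i)‖ₑ ^ 2
  have hx (x : H) : ‖(star T) x‖ₑ ^ 2 ≤ S * ‖x‖ₑ ^ 2 := by
    rw [← e.tsum_enorm_inner_sq, ← ENNReal.tsum_mul_right]
    refine ENNReal.tsum_le_tsum fun i => ?_
    rw [ContinuousLinearMap.star_eq_adjoint, ContinuousLinearMap.adjoint_inner_right, ← mul_pow]
    gcongr
    simp only [enorm_eq_nnnorm, ← ENNReal.coe_mul, ENNReal.coe_le_coe]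
    exact nnnorm_inner_le_nnnorm _ _
  have hn : ‖star T‖ ≤ √S.toReal := by
    refine ContinuousLinearMap.opNorm_le_bound _ (Real.sqrt_nonneg _) fun x => ?_
    refine le_of_sq_le_sq ?_ (by positivity)
    rw [mul_pow, Real.sq_sqrt ENNReal.toReal_nonneg]
    have := ENNReal.toReal_mono (by finiteness) (hx x)
    simpa using this
  rw [hT, ← ofReal_norm, ← ENNReal.ofReal_pow (norm_nonneg _), ← ENNReal.ofReal_toReal h]
  refine ENNReal.ofReal_le_ofReal ?_
  calc ‖star T‖ ^ 2 ≤ (√S.toReal) ^ 2 := by gcongr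
    _ = _ := Real.sq_sqrt ENNReal.toReal_nonneg

theorem HilbertBasis.isCompactOperator_of_tsum_ne_top (e : HilbertBasis ι ℂ H) (T : H →L[ℂ] H)
    (hT : ∑' i, ‖T (e i)‖ₑ ^ 2 ≠ ∞) : IsCompactOperator T := by
  classical
  -- Finite-rank truncations of T; the squared error is at most a tail of the Hilbert–Schmidt sum.
  let R (s : Finset ι) : H →L[ℂ] H := ∑ i ∈ s, InnerProductSpace.rankOne ℂ (T (e i)) (e i)
  have hR (s : Finset ι) (j : ι) : R s (e j) = if j ∈ s then T (e j) else 0 := by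
    simp [R, InnerProductSpace.rankOne_apply,
      orthonormal_iff_ite.mp e.orthonormal]
  have hle (s : Finset ι) : ‖T - R s‖ₑ ^ 2 ≤ ∑' i : {i // i ∉ s}, ‖T (e i)‖ₑ ^ 2 := by
    refine (e.enorm_sq_le_tsum _).trans (le_of_eq ?_)
    have := tsum_subtype {i | i ∉ s} fun i => ‖T (e i)‖ₑ ^ 2
    refine Eq.trans ?_ this.symm
    refine tsum_congr fun i => ?_
    by_cases hi : i ∈ s <;> simp [hR, hi]
  have hlim : Filter.Tendsto R Filter.atTop (nhds T) := by
    rw [tendsto_iff_edist_tendsto_0]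
    have h0 : Filter.Tendsto (fun s => ‖T - R s‖ₑ ^ 2) Filter.atTop (nhds 0) :=
      tendsto_of_tendsto_of_tendsto_of_le_of_le tendsto_const_nhds
        (ENNReal.tendsto_tsum_compl_atTop_zero hT) (fun _ => zero_le) hle
    have h1 := (ENNReal.continuous_rpow_const (y := 2⁻¹)).tendsto 0 |>.comp h0
    rw [ENNReal.zero_rpow_of_pos (by norm_num)] at h1
    refine h1.congr fun s => ?_
    rw [edist_comm, edist_eq_enorm_sub]
    change (‖T - R s‖ₑ ^ 2) ^ (2⁻¹ : ℝ) = _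
    rw [← ENNReal.rpow_natCast, ← ENNReal.rpow_mul]
    norm_num
  refine isCompactOperator_of_tendsto hlim (Filter.Eventually.of_forall fun s => ?_)
  have : ∀ t : Finset ι, IsCompactOperator (R t) := fun t => by
    induction t using Finset.induction_on with
    | empty => simpa [R] using isCompactOperator_zero
    | insert a t ha ih =>
      have h := (ContinuousLinearMap.isCompactOperator_rankOne (T (e a)) (e a)).add ih
      simpa [R, Finset.sum_insert ha] using h
  exact this s

end HilbertSchmidt

/-! ### Diagonalization of compact self-adjoint operators. -/

section Eigenbasis

universe u

variable {H : Type u} [NormedAddCommGroup H] [InnerProductSpace ℂ H] [CompleteSpace H]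

/-- A compact self-adjoint operator has a Hilbert basis of eigenvectors. -/
theorem ContinuousLinearMap.exists_hilbertBasis_eigenvectors {T : H →L[ℂ] H}
    (hc : IsCompactOperator T) (hT : IsSelfAdjoint T) :
    ∃ (κ : Type u) (b : HilbertBasis κ ℂ H) (μ : κ → ℝ), ∀ j, T (b j) = (μ j : ℂ) • b j := by
  have hs : T.IsSymmetric := hT.isSymmetric
  let V (z : ℂ) : Submodule ℂ H := Module.End.eigenspace (T : Module.End ℂ H) z
  have hV (z : ℂ) : IsClosed (V z : Set H) := by
    have : (V z : Set H) = {x | T x = z • x} := by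
      ext x
      exact Module.End.mem_eigenspace_iff
    rw [this]
    exact isClosed_eq T.continuous (continuous_const_smul z)
  have (z : ℂ) : CompleteSpace (V z) := (hV z).completeSpace_coe
  choose w c hc' using fun z => exists_hilbertBasis ℂ (V z)
  -- Glue bases of all eigenspaces, kernel included; trivial eigenspaces contribute no vectors.
  let v : (Σ z, w z) → H := fun a => (c a.1 a.2 : H)
  have hv : Orthonormal ℂ v :=
    hs.orthogonalFamily_eigenspaces.orthonormal_sigma_orthonormal fun z => (c z).orthonormal
  have hsp : (Submodule.span ℂ (Set.range v))ᗮ = ⊥ := by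
    rw [eq_bot_iff, ← ContinuousLinearMap.orthogonalComplement_iSup_eigenspaces_eq_bot hc hs]
    rw [← Submodule.orthogonal_closure (Submodule.span ℂ (Set.range v))]
    refine Submodule.orthogonal_le (iSup_le fun z x hx => ?_)
    have h := ((c z).hasSum_repr ⟨x, hx⟩).mapL (V z).subtypeL
    refine mem_closure_of_tendsto h (Filter.Eventually.of_forall fun s => ?_)
    refine Submodule.sum_mem _ fun i _ => ?_
    rw [map_smul]
    exact Submodule.smul_mem _ _ (Submodule.subset_span ⟨⟨z, i⟩, rfl⟩)
  have heig (a : Σ z, w z) : T (v a) = a.1 • v a :=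
    Module.End.mem_eigenspace_iff.mp (c a.1 a.2).2
  refine ⟨_, HilbertBasis.mkOfOrthogonalEqBot hv hsp, fun a => a.1.re, fun a => ?_⟩
  rw [HilbertBasis.coe_mkOfOrthogonalEqBot, heig]
  have hre : (starRingEnd ℂ) a.1 = a.1 :=
    hs.conj_eigenvalue_eq_self (Module.End.hasEigenvalue_of_hasEigenvector
      ⟨(c a.1 a.2).2, hv.ne_zero a⟩)
  rw [Complex.conj_eq_iff_re.mp hre]

end Eigenbasis

/-! ### Integrality for pairs of projections. -/

section PairsOfProjections

variable {H : Type*} [NormedAddCommGroup H] [InnerProductSpace ℂ H] [CompleteSpace H]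

theorem IsStarProjection.inner_apply_left {E : H →L[ℂ] H} (hE : IsStarProjection E) (x y : H) :
    ⟪E x, y⟫_ℂ = ⟪x, E y⟫_ℂ :=
  hE.isSelfAdjoint.isSymmetric x y

theorem IsStarProjection.apply_apply {E : H →L[ℂ] H} (hE : IsStarProjection E) (x : H) :
    E (E x) = E x :=
  DFunLike.congr_fun hE.isIdempotentElem x

theorem IsStarProjection.inner_apply_self {E : H →L[ℂ] H} (hE : IsStarProjection E) (x : H) :
    ⟪x, E x⟫_ℂ = ((‖E x‖ ^ 2 : ℝ) : ℂ) := by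
  rw [← hE.apply_apply, ← hE.inner_apply_left, inner_self_eq_norm_sq_to_K, hE.apply_apply]
  simp

theorem IsStarProjection.norm_one_sub_apply_sq {E : H →L[ℂ] H} (hE : IsStarProjection E) (x : H) :
    ‖(1 - E) x‖ ^ 2 = ‖x‖ ^ 2 - ‖E x‖ ^ 2 := by
  have h : (⟪x, (1 - E) x⟫_ℂ) = ((‖x‖ ^ 2 - ‖E x‖ ^ 2 : ℝ) : ℂ) := by
    rw [sub_apply, inner_sub_right, hE.inner_apply_self]
    simp
  rw [hE.one_sub.inner_apply_self] at h
  exact_mod_cast h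

section EigenvectorOfDifference

variable {E F : H →L[ℂ] H} {x : H} {μ : ℝ}

/-- Applying E to Ex - Fx = μx gives EFx = (1 - μ)Ex; applying EF gives EFEx = (1 + μ)EFx. -/
theorem IsStarProjection.apply_apply_apply_of_sub_eigenvector (hE : IsStarProjection E)
    (hF : IsStarProjection F) (hx : (E - F) x = (μ : ℂ) • x) :
    E (F (E x)) = ((1 - μ ^ 2 : ℝ) : ℂ) • E x := by
  have h1 : E x - F x = (μ : ℂ) • x := hx
  have h2 : E x - E (F x) = (μ : ℂ) • E x := by
    simpa [hE.apply_apply] using congrArg E h1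
  have h3 : E (F (E x)) - E (F x) = (μ : ℂ) • E (F x) := by
    simpa [hF.apply_apply] using congrArg (fun y => E (F y)) h1
  have h4 : E (F x) = E x - (μ : ℂ) • E x := by rw [← h2]; abel
  rw [h4] at h3
  rw [sub_eq_iff_eq_add.mp h3]
  push_cast
  module

theorem IsStarProjection.norm_apply_apply_sq_of_sub_eigenvector (hE : IsStarProjection E)
    (hF : IsStarProjection F) (hx : (E - F) x = (μ : ℂ) • x) :
    ‖F (E x)‖ ^ 2 = (1 - μ ^ 2) * ‖E x‖ ^ 2 := by
  have h := hF.inner_apply_self (E x)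
  rw [hE.inner_apply_left, hE.apply_apply_apply_of_sub_eigenvector hF hx, inner_smul_right,
    hE.inner_apply_self] at h
  exact_mod_cast h.symm

/-- Off μ = ±1 this is Pythagoras. At μ = ±1, FEx = 0; moreover Ex = x if μ = 1, and Ex = 0 if μ =
-1. -/
theorem IsStarProjection.norm_one_sub_apply_sq_of_sub_eigenvector (hE : IsStarProjection E)
    (hF : IsStarProjection F) (hx : (E - F) x = (μ : ℂ) • x) (hn : ‖x‖ = 1) :
    ‖(1 - F) (E x)‖ ^ 2 = μ ^ 2 / (1 - μ ^ 2) * ‖F (E x)‖ ^ 2 + if μ = 1 then 1 else 0 := by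
  have h1 := hE.norm_apply_apply_sq_of_sub_eigenvector hF hx
  have h2 : ‖E x‖ ^ 2 - ‖F x‖ ^ 2 = μ := by
    have h : ⟪x, (E - F) x⟫_ℂ = ⟪x, (μ : ℂ) • x⟫_ℂ := by rw [hx]
    rw [sub_apply, inner_sub_right, hE.inner_apply_self, hF.inner_apply_self,
      inner_smul_right, inner_self_eq_norm_sq_to_K, hn] at h
    norm_num at h
    exact_mod_cast h
  have h3 := hE.norm_one_sub_apply_sq x
  have h4 := hF.norm_one_sub_apply_sq x
  rw [hF.norm_one_sub_apply_sq, h1]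
  rw [hn] at h3 h4
  have h5 := sq_nonneg ‖(1 - E) x‖
  have h6 := sq_nonneg ‖(1 - F) x‖
  have h7 := sq_nonneg ‖E x‖
  have h8 := sq_nonneg ‖F x‖
  by_cases hp : μ = 1
  · subst hp
    rw [if_pos rfl, show (1 : ℝ) - 1 ^ 2 = 0 by norm_num, zero_mul, mul_zero]
    linarith
  · rw [if_neg hp]
    by_cases hm : μ = -1
    · subst hm
      rw [show (1 : ℝ) - (-1) ^ 2 = 0 by norm_num, zero_mul, mul_zero]
      linarith
    · have : (1 - μ ^ 2) ≠ 0 := by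
        intro h
        have : (1 - μ) * (1 + μ) = 0 := by linarith
        rcases mul_eq_zero.mp this with h | h
        · exact hp (by linarith)
        · exact hm (by linarith)
      field_simp
      ring

end EigenvectorOfDifference

variable {κ : Type*}

/-- If `b` diagonalizes the difference of the projections `E` and `F`, then `F E` and `E F` have
the same Hilbert–Schmidt norm, also with a weight that depends only on the squared eigenvalue. -/
theorem HilbertBasis.tsum_weight_mul_enorm_sq_comm {E F : H →L[ℂ] H} (hE : IsStarProjection E)
    (hF : IsStarProjection F) (b : HilbertBasis κ ℂ H) (μ : κ → ℝ)
    (hb : ∀ j, (E - F) (b j) = (μ j : ℂ) • b j) (g : ℝ → ℝ≥0∞) :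
    ∑' j, g (μ j ^ 2) * ‖F (E (b j))‖ₑ ^ 2 = ∑' j, g (μ j ^ 2) * ‖E (F (b j))‖ₑ ^ 2 := by
  have hD (x y : H) : ⟪(E - F) x, y⟫_ℂ = ⟪x, (E - F) y⟫_ℂ :=
    (hE.isSelfAdjoint.sub hF.isSelfAdjoint).isSymmetric x y
  -- (E - F)² commutes with both projections, so FE has no matrix entries between different values
  -- of μ².
  have hcomm (x : H) : (E - F) ((E - F) (F (E x))) = F (E ((E - F) ((E - F) x))) := by
    simp only [sub_apply, map_sub, hE.apply_apply, hF.apply_apply]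
    abel
  have hzero (j k : κ) (h : μ j ^ 2 ≠ μ k ^ 2) : ⟪b k, F (E (b j))⟫_ℂ = 0 := by
    have h1 : ⟪(E - F) ((E - F) (b k)), F (E (b j))⟫_ℂ
        = ⟪b k, F (E ((E - F) ((E - F) (b j))))⟫_ℂ := by
      rw [hD, hD, hcomm]
    simp only [hb, map_smul, inner_smul_left, inner_smul_right, Complex.conj_ofReal] at h1
    have h2 : (((μ k ^ 2 - μ j ^ 2 : ℝ)) : ℂ) * ⟪b k, F (E (b j))⟫_ℂ = 0 := by
      push_cast
      linear_combination h1
    refine (mul_eq_zero.mp h2).resolve_left ?_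
    rw [Complex.ofReal_eq_zero, sub_eq_zero]
    exact h.symm
  simp_rw [← b.tsum_enorm_inner_sq (F (E _)), ← b.tsum_enorm_inner_sq (E (F _)),
    ← ENNReal.tsum_mul_left]
  rw [ENNReal.tsum_comm]
  refine tsum_congr fun k => tsum_congr fun j => ?_
  have hs : ‖⟪b j, E (F (b k))⟫_ℂ‖ₑ = ‖⟪b k, F (E (b j))⟫_ℂ‖ₑ := by
    rw [← hE.inner_apply_left, ← hF.inner_apply_left, ← inner_conj_symm, RCLike.enorm_conj]
  rw [hs]
  by_cases h : μ j ^ 2 = μ k ^ 2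
  · rw [h]
  · simp [hzero j k h]

/-- Isolates the asymmetry between E and F: the weighted sum is unchanged when they are swapped, and
only the count of eigenvalues 1 changes. -/
theorem HilbertBasis.tsum_enorm_one_sub_sq {E F : H →L[ℂ] H} (hE : IsStarProjection E)
    (hF : IsStarProjection F) (b : HilbertBasis κ ℂ H) (μ : κ → ℝ)
    (hb : ∀ j, (E - F) (b j) = (μ j : ℂ) • b j) :
    ∑' j, ‖(1 - F) (E (b j))‖ₑ ^ 2 =
      ∑' j, ENNReal.ofReal (μ j ^ 2 / (1 - μ j ^ 2)) * ‖F (E (b j))‖ₑ ^ 2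
        + ({j | μ j = 1}.encard : ℝ≥0∞) := by
  have hn (y : H) : ‖y‖ₑ ^ 2 = ENNReal.ofReal (‖y‖ ^ 2) := by
    rw [ENNReal.ofReal_pow (norm_nonneg _), ofReal_norm]
  rw [← ENNReal.tsum_set_one, tsum_subtype {j | μ j = 1} fun _ => (1 : ℝ≥0∞), ← ENNReal.tsum_add]
  refine tsum_congr fun j => ?_
  have h1 := hE.norm_one_sub_apply_sq_of_sub_eigenvector hF (hb j) (b.orthonormal.1 j)
  have h2 := hE.norm_apply_apply_sq_of_sub_eigenvector hF (hb j)
  rw [hn, hn, h1, ← ENNReal.ofReal_mul' (by positivity), ENNReal.ofReal_add]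
  · congr 1
    by_cases h : μ j = 1 <;> simp [h]
  · rcases le_or_gt 0 (1 - μ j ^ 2) with h | h
    · positivity
    -- Where the weight would be negative, and `ENNReal.ofReal` would truncate it, FE(b j) vanishes.
    · have : ‖F (E (b j))‖ ^ 2 = 0 := by
        refine le_antisymm ?_ (by positivity)
        rw [h2]
        exact mul_nonpos_of_nonpos_of_nonneg h.le (by positivity)
      simp [this]
  · split_ifs <;> norm_num

variable {ι : Type*}

/-- If the difference of two projections is a Hilbert–Schmidt operator, then the traces of its two
positive diagonal corners differ by an integer. -/
theorem HilbertBasis.exists_int_tsum_sub_tsum {E F : H →L[ℂ] H} (hE : IsStarProjection E)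
    (hF : IsStarProjection F) (e : HilbertBasis ι ℂ H)
    (h₁ : ∑' i, ‖E ((1 - F) (e i))‖ₑ ^ 2 ≠ ∞) (h₂ : ∑' i, ‖(1 - E) (F (e i))‖ₑ ^ 2 ≠ ∞) :
    ∃ m : ℤ, (∑' i, ‖E ((1 - F) (e i))‖ₑ ^ 2).toReal
      - (∑' i, ‖(1 - E) (F (e i))‖ₑ ^ 2).toReal = m := by
  have hsq (x y : ℝ≥0∞) : (x + y) ^ 2 ≤ 2 * (x ^ 2 + y ^ 2) := by
    have := ENNReal.rpow_add_le_mul_rpow_add_rpow x y one_le_two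
    norm_num at this
    exact_mod_cast this
  have hD : ∑' i, ‖(E - F) (e i)‖ₑ ^ 2 ≠ ∞ := by
    have hle : ∑' i, ‖(E - F) (e i)‖ₑ ^ 2 ≤
        2 * (∑' i, ‖E ((1 - F) (e i))‖ₑ ^ 2 + ∑' i, ‖(1 - E) (F (e i))‖ₑ ^ 2) := by
      rw [← ENNReal.tsum_add, ← ENNReal.tsum_mul_left]
      refine ENNReal.tsum_le_tsum fun i => ?_
      have h : (E - F) (e i) = E ((1 - F) (e i)) - (1 - E) (F (e i)) := by simp
      rw [h]
      calc _ ≤ (‖E ((1 - F) (e i))‖ₑ + ‖(1 - E) (F (e i))‖ₑ) ^ 2 := by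
            gcongr
            exact enorm_sub_le
        _ ≤ _ := hsq _ _
    exact ne_top_of_le_ne_top (by finiteness) hle
  obtain ⟨κ, b, μ, hb⟩ := ContinuousLinearMap.exists_hilbertBasis_eigenvectors
    (e.isCompactOperator_of_tsum_ne_top _ hD) (hE.isSelfAdjoint.sub hF.isSelfAdjoint)
  have e1 : ∑' i, ‖E ((1 - F) (e i))‖ₑ ^ 2 = ∑' j, ‖(1 - F) (E (b j))‖ₑ ^ 2 := by
    have := e.tsum_enorm_apply_sq_eq_adjoint b (E * (1 - F))
    simpa [star_mul, hE.isSelfAdjoint.star_eq, hF.isSelfAdjoint.star_eq] using this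
  -- Taking adjoints twice changes the basis but keeps the order of the factors.
  have e2 : ∑' i, ‖(1 - E) (F (e i))‖ₑ ^ 2 = ∑' j, ‖(1 - E) (F (b j))‖ₑ ^ 2 :=
    (e.tsum_enorm_apply_sq_eq_adjoint b ((1 - E) * F)).trans
      (b.tsum_enorm_apply_sq_eq_adjoint b ((1 - E) * F)).symm
  have hb' (j : κ) : (F - E) (b j) = ((-μ j : ℝ) : ℂ) • b j := by
    rw [← neg_sub, neg_apply, hb]
    simp
  have s1 := HilbertBasis.tsum_enorm_one_sub_sq hE hF b μ hb
  have s2 := HilbertBasis.tsum_enorm_one_sub_sq hF hE b (fun j => -μ j) hb'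
  have s3 := HilbertBasis.tsum_weight_mul_enorm_sq_comm hE hF b μ hb
    fun t => ENNReal.ofReal (t / (1 - t))
  simp only [neg_sq] at s2
  rw [e1, s1] at h₁ ⊢
  rw [e2, s2, ← s3] at h₂ ⊢
  -- The common weighted sum is finite and cancels, leaving a difference of two finite
  -- cardinalities.
  obtain ⟨hg, c1⟩ := ENNReal.add_ne_top.mp h₁
  obtain ⟨-, c2⟩ := ENNReal.add_ne_top.mp h₂
  have key (n : ℕ∞) (hn : (n : ℝ≥0∞) ≠ ∞) : ∃ m : ℕ, (n : ℝ≥0∞) = m := by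
    induction n using ENat.recTopCoe with
    | top => simp at hn
    | coe m => exact ⟨m, by simp⟩
  obtain ⟨m1, hm1⟩ := key _ c1
  obtain ⟨m2, hm2⟩ := key _ c2
  rw [hm1, hm2, ENNReal.toReal_add hg (by simp), ENNReal.toReal_add hg (by simp)]
  refine ⟨m1 - m2, ?_⟩
  simp

end PairsOfProjections

/-! ### Distance and weight estimates in the polygon. -/

section Geometry

theorem exists_infDist_le_mul_norm_prod_sub (X : Finset ℂ)
    (hX : (X : Set ℂ).Nontrivial) :
    ∃ c : ℝ, 0 < c ∧ ∀ z, c * Metric.infDist z (X : Set ℂ) ≤ ‖∏ l ∈ X, (z - l)‖ := by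
  let δ := (X : Set ℂ).infsep
  have hδ : 0 < δ := X.finite_toSet.infsep_pos_iff_nontrivial.mpr hX
  -- If x is the vertex nearest to z, any other vertex y has δ ≤ |y - x| ≤ 2|z - y|.
  refine ⟨(δ / 2) ^ (X.card - 1), by positivity, fun z => ?_⟩
  obtain ⟨x, hx, hd⟩ := X.finite_toSet.isCompact.exists_infDist_eq_dist hX.nonempty z
  rw [← Finset.mul_prod_erase X _ hx, norm_mul, norm_prod, hd, mul_comm, dist_eq_norm,
    ← Finset.card_erase_of_mem hx, ← Finset.prod_const]
  gcongr with y hy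
  obtain ⟨hne, hy⟩ := Finset.mem_erase.mp hy
  have h1 : δ ≤ dist y x := Set.infsep_le_dist_of_mem hy hx hne
  have h2 : dist z x ≤ dist z y := hd ▸ Metric.infDist_le_dist_of_mem hy
  have h3 := dist_triangle_left y x z
  rw [← dist_eq_norm]
  linarith

theorem IsConvexPolygon.mem_limOne {P : Set ℂ} {X : Finset ℂ} (hP : IsConvexPolygon P X)
    {d : ℕ → ℂ} (hdP : ∀ n, d n ∈ P) (hd : Summable fun n => ‖∏ l ∈ X, (d n - l)‖) :
    d ∈ LimOne X := by
  refine ⟨?_, ?_⟩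
  · have : Bornology.IsBounded P := by
      rw [hP.eq_convexHull, isBounded_convexHull]
      exact X.finite_toSet.isBounded
    exact this.subset (Set.range_subset_iff.mpr hdP)
  · obtain ⟨c, hc, h⟩ := exists_infDist_le_mul_norm_prod_sub X
      (Finset.one_lt_card_iff_nontrivial.mp hP.two_le_card)
    refine Summable.of_nonneg_of_le (fun _ => Metric.infDist_nonneg) (fun n => ?_)
      (hd.mul_left c⁻¹)
    rw [le_inv_mul_iff₀ hc]
    exact h _

/-- A convex combination of the vertices of a polygon that is close to a vertex puts almost all of
its weight on this vertex. -/
theorem IsConvexPolygon.exists_one_sub_weight_le {P : Set ℂ} {X : Finset ℂ}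
    (hP : IsConvexPolygon P X) {x : ℂ} (hx : x ∈ X) :
    ∃ C : ℝ, 0 < C ∧ ∀ w : ℂ → ℝ, (∀ l ∈ X, 0 ≤ w l) → ∑ l ∈ X, w l = 1 →
      1 - w x ≤ C * ‖∑ l ∈ X, (w l : ℂ) * l - x‖ := by
  have hPc : Convex ℝ P := hP.eq_convexHull ▸ convex_convexHull ℝ _
  let K := convexHull ℝ ((X.erase x : Finset ℂ) : Set ℂ)
  have hxK : x ∉ K := by
    have hxe : x ∈ P.extremePoints ℝ := hP.extremePoints_eq ▸ hx
    have h := (Convex.mem_extremePoints_iff_mem_sdiff_convexHull_sdiff hPc).mp hxe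
    refine fun hK => h.2 (convexHull_mono (fun y hy => ?_) hK)
    obtain ⟨hne, hy⟩ := Finset.mem_erase.mp (Finset.mem_coe.mp hy)
    exact ⟨hP.eq_convexHull ▸ subset_convexHull ℝ _ hy, hne⟩
  have hne : (X.erase x).Nonempty := by
    rw [← Finset.card_pos, Finset.card_erase_of_mem hx]
    have := hP.two_le_card
    omega
  have hKn : K.Nonempty := (Finset.coe_nonempty.mpr hne).convexHull
  have hKc : IsClosed K := (X.erase x).finite_toSet.isClosed_convexHull ℝ
  have hr : 0 < Metric.infDist x K := (hKc.notMem_iff_infDist_pos hKn).mp hxK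
  refine ⟨(Metric.infDist x K)⁻¹, inv_pos.mpr hr, fun w hw hsum => ?_⟩
  rw [le_inv_mul_iff₀ hr]
  rw [← Finset.add_sum_erase X _ hx] at hsum ⊢
  have hs : ∑ l ∈ X.erase x, w l = 1 - w x := by linarith
  have hnn : 0 ≤ 1 - w x :=
    hs ▸ Finset.sum_nonneg fun l hl => hw l (Finset.mem_of_mem_erase hl)
  rcases hnn.eq_or_lt with h | h
  · rw [← h, mul_zero]
    positivity
  -- The barycentre y of the remaining weights lies in K, and the combination minus x is (1 - w x)(y
  -- - x).
  let y : ℂ := (X.erase x).centerMass w id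
  have hy : y ∈ K := (X.erase x).centerMass_mem_convexHull
    (fun l hl => hw l (Finset.mem_of_mem_erase hl)) (hs ▸ h) fun l hl => hl
  have hye : ((1 - w x : ℝ) : ℂ) * y = ∑ l ∈ X.erase x, (w l : ℂ) * l := by
    have hc : ((1 - w x : ℝ) : ℂ) ≠ 0 := Complex.ofReal_ne_zero.mpr h.ne'
    simp only [y, Finset.centerMass, hs, id, Complex.real_smul, Complex.ofReal_inv]
    rw [mul_inv_cancel_left₀ hc]
  have : (w x : ℂ) * x + ∑ l ∈ X.erase x, (w l : ℂ) * l - x = ((1 - w x : ℝ) : ℂ) * (y - x) := by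
    rw [← hye]
    push_cast
    ring
  rw [this, norm_mul, Complex.norm_real, Real.norm_of_nonneg hnn, mul_comm]
  gcongr
  rw [← dist_eq_norm, dist_comm]
  exact Metric.infDist_le_dist_of_mem hy

end Geometry

/-! ### Spectral projections for finite spectrum. -/

section Spectral

variable {A : Type*} [CStarAlgebra A]

/-- A normal element with finite spectrum is a linear combination of projections with sum one. -/
theorem IsStarNormal.exists_isStarProjection_sum {a : A} [IsStarNormal a] {X : Finset ℂ}
    (ha : spectrum ℂ a = (X : Set ℂ)) :
    ∃ E : ℂ → A, (∀ l, IsStarProjection (E l)) ∧ ∑ l ∈ X, E l = 1 ∧ ∑ l ∈ X, l • E l = a := by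
  classical
  -- Indicators of points are continuous on the finite spectrum, so the functional calculus applies.
  let f (l z : ℂ) : ℂ := if z = l then 1 else 0
  have hc (g : ℂ → ℂ) : ContinuousOn g (spectrum ℂ a) := by
    rw [ha]
    exact X.finite_toSet.continuousOn g
  refine ⟨fun l => cfc (f l) a, fun l => ⟨?_, ?_⟩, ?_, ?_⟩
  · rw [IsIdempotentElem, ← cfc_mul _ _ _ (hc _) (hc _)]
    congr 1
    ext z
    simp [f]
  · rw [IsSelfAdjoint, ← cfc_star]
    congr 1
    ext z
    by_cases h : z = l <;> simp [f, h]
  · rw [← cfc_sum _ _ _ fun _ _ => hc _, ← cfc_one ℂ a]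
    refine cfc_congr fun z hz => ?_
    have hz' : z ∈ X := by simpa [ha] using hz
    simp [f, hz']
  · simp_rw [← cfc_const_mul _ _ _ (hc _)]
    rw [← cfc_sum _ _ _ fun _ _ => hc _]
    refine (cfc_congr fun z hz => ?_).trans (cfc_id ℂ a)
    have hz' : z ∈ X := by simpa [ha] using hz
    simp [f, hz']

end Spectral

/-! ### Diagonals and the obstruction subgroup. -/

section Diagonals

variable {H : Type*} [NormedAddCommGroup H] [InnerProductSpace ℂ H] [CompleteSpace H]
variable {ι : Type*}

theorem HilbertBasis.exists_int_hasSum_sub {E F : H →L[ℂ] H} (hE : IsStarProjection E)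
    (hF : IsStarProjection F) (e : HilbertBasis ι ℂ H)
    (h₁ : Summable fun i => ‖E ((1 - F) (e i))‖ ^ 2)
    (h₂ : Summable fun i => ‖(1 - E) (F (e i))‖ ^ 2) :
    ∃ m : ℤ, HasSum (fun i => ‖E ((1 - F) (e i))‖ ^ 2 - ‖(1 - E) (F (e i))‖ ^ 2) (m : ℝ) := by
  have hn (f : ι → H) (hf : Summable fun i => ‖f i‖ ^ 2) :
      ∑' i, ‖f i‖ₑ ^ 2 = ENNReal.ofReal (∑' i, ‖f i‖ ^ 2) := by
    rw [ENNReal.ofReal_tsum_of_nonneg (fun _ => by positivity) hf]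
    refine tsum_congr fun i => ?_
    rw [ENNReal.ofReal_pow (norm_nonneg _), ofReal_norm]
  obtain ⟨m, hm⟩ := e.exists_int_tsum_sub_tsum hE hF
    (by rw [hn _ h₁]; exact ENNReal.ofReal_ne_top) (by rw [hn _ h₂]; exact ENNReal.ofReal_ne_top)
  rw [hn _ h₁, hn _ h₂, ENNReal.toReal_ofReal (tsum_nonneg fun _ => by positivity),
    ENNReal.toReal_ofReal (tsum_nonneg fun _ => by positivity)] at hm
  exact ⟨m, hm ▸ h₁.hasSum.sub h₂.hasSum⟩

theorem HilbertBasis.exists_isStarProjection_apply_eq_ite (e : HilbertBasis ι ℂ H) (p : ι → Prop)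
    [DecidablePred p] :
    ∃ F : H →L[ℂ] H, IsStarProjection F ∧ ∀ i, F (e i) = if p i then e i else 0 := by
  let V := (Submodule.span ℂ (e '' {i | p i})).topologicalClosure
  have : CompleteSpace V := (Submodule.isClosed_topologicalClosure _).completeSpace_coe
  refine ⟨V.starProjection, isStarProjection_starProjection, fun i => ?_⟩
  split_ifs with h
  · exact Submodule.starProjection_eq_self_iff.mpr
      (Submodule.le_topologicalClosure _ (Submodule.subset_span ⟨i, h, rfl⟩))
  · rw [Submodule.starProjection_apply_eq_zero_iff, Submodule.orthogonal_closure,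
      Submodule.mem_orthogonal]
    intro u hu
    induction hu using Submodule.span_induction with
    | mem u hu =>
      obtain ⟨j, hj, rfl⟩ := hu
      exact e.orthonormal.2 fun hji => h (hji ▸ hj)
    | zero => simp
    | add u v _ _ hu hv => rw [inner_add_left, hu, hv, add_zero]
    | smul c u _ hu => rw [inner_smul_left, hu, mul_zero]

/-- The diagonal of a projection that is close to a diagonal projection `1_p` has an integral
renormalized sum. -/
theorem HilbertBasis.exists_int_hasSum_norm_sq_sub_ite {E : H →L[ℂ] H} (hE : IsStarProjection E)
    (e : HilbertBasis ι ℂ H) (p : ι → Prop) [DecidablePred p]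
    (h : Summable fun i => if p i then 1 - ‖E (e i)‖ ^ 2 else ‖E (e i)‖ ^ 2) :
    ∃ m : ℤ, HasSum (fun i => ‖E (e i)‖ ^ 2 - if p i then 1 else 0) (m : ℝ) := by
  obtain ⟨F, hF, hFe⟩ := e.exists_isStarProjection_apply_eq_ite p
  have hE1 (i : ι) : ‖(1 - E) (e i)‖ ^ 2 = 1 - ‖E (e i)‖ ^ 2 := by
    rw [hE.norm_one_sub_apply_sq, e.orthonormal.1 i, one_pow]
  have h1 (i : ι) : ‖E ((1 - F) (e i))‖ ^ 2 = if p i then 0 else ‖E (e i)‖ ^ 2 := by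
    rw [sub_apply, hFe]
    by_cases hp : p i <;> simp [hp]
  have h2 (i : ι) : ‖(1 - E) (F (e i))‖ ^ 2 = if p i then 1 - ‖E (e i)‖ ^ 2 else 0 := by
    rw [hFe, ← hE1]
    by_cases hp : p i <;> simp [hp]
  have hnn (i : ι) : 0 ≤ 1 - ‖E (e i)‖ ^ 2 := hE1 i ▸ sq_nonneg _
  -- For each i one of the two terms is zero; in both cases their difference is the diagonal entry
  -- minus the indicator.
  obtain ⟨m, hm⟩ := e.exists_int_hasSum_sub hE hF
    (h.of_nonneg_of_le (fun _ => by positivity) fun i => by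
      rw [h1]; split_ifs; exacts [hnn i, le_rfl])
    (h.of_nonneg_of_le (fun _ => by positivity) fun i => by
      rw [h2]; split_ifs; exacts [le_rfl, sq_nonneg _])
  refine ⟨m, hm.congr_fun fun i => ?_⟩
  rw [h1, h2]
  split_ifs <;> ring

theorem IsConvexPolygon.tsum_diagonalSeq_sub_mem_obstructionSubgroup {P : Set ℂ} {X : Finset ℂ}
    (hP : IsConvexPolygon P X) (e : HilbertBasis ℕ ℂ H) (A : H →L[ℂ] H) [IsStarNormal A]
    (hA : spectrum ℂ A = (X : Set ℂ)) {x : ℕ → ℂ} (hx : IsApproximant X (diagonalSeq e A) x) :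
    ∑' n, (diagonalSeq e A n - x n) ∈ obstructionSubgroup X := by
  classical
  obtain ⟨E, hE, hE1, hEA⟩ := IsStarNormal.exists_isStarProjection_sum hA
  let w (n : ℕ) (l : ℂ) : ℝ := ‖E l (e n)‖ ^ 2
  have hw (n : ℕ) (l : ℂ) : 0 ≤ w n l := sq_nonneg _
  have hw1 (n : ℕ) : ∑ l ∈ X, w n l = 1 := by
    have h : ⟪e n, (∑ l ∈ X, E l) (e n)⟫_ℂ = 1 := by
      rw [hE1, one_apply_eq_self, inner_self_eq_norm_sq_to_K, e.orthonormal.1 n]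
      simp
    rw [sum_apply, inner_sum] at h
    simp_rw [(hE _).inner_apply_self] at h
    exact_mod_cast h
  have hd (n : ℕ) : diagonalSeq e A n = ∑ l ∈ X, (w n l : ℂ) * l := by
    rw [diagonalSeq, ← hEA, sum_apply, inner_sum]
    refine Finset.sum_congr rfl fun l _ => ?_
    rw [smul_apply, inner_smul_right, (hE l).inner_apply_self, mul_comm]
  choose! C hC0 hC using fun l (hl : l ∈ X) => hP.exists_one_sub_weight_le hl
  have hbound (n : ℕ) : 1 - w n (x n) ≤ (∑ l ∈ X, C l) * ‖diagonalSeq e A n - x n‖ := by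
    refine (hC _ (hx.1 n) (w n) (fun l _ => hw n l) (hw1 n)).trans ?_
    rw [← hd]
    gcongr
    exact Finset.single_le_sum (fun l hl => (hC0 l hl).le) (hx.1 n)
  have hle (n : ℕ) (l : ℂ) (hl : l ∈ X) (hne : x n ≠ l) : w n l ≤ 1 - w n (x n) := by
    rw [← hw1 n, ← Finset.add_sum_erase X _ (hx.1 n), add_sub_cancel_left]
    exact Finset.single_le_sum (fun l _ => hw n l) (Finset.mem_erase.mpr ⟨hne.symm, hl⟩)
  have hint (l : ℂ) (hl : l ∈ X) :
      ∃ m : ℤ, HasSum (fun n => w n l - if x n = l then 1 else 0) (m : ℝ) := by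
    refine e.exists_int_hasSum_norm_sq_sub_ite (hE l) (fun n => x n = l) ?_
    refine (hx.2.mul_left (∑ l ∈ X, C l)).of_nonneg_of_le (fun n => ?_) fun n => ?_
    · split_ifs with h
      · have := Finset.single_le_sum (fun l _ => hw n l) hl
        rw [hw1] at this
        exact sub_nonneg.mpr this
      · exact hw n l
    · split_ifs with h
      · subst h
        exact hbound n
      · exact (hle n l hl h).trans (hbound n)
  choose! ν hν using hint
  -- The coefficients sum to zero because, for each n, the weights and the indicators both sum to 1
  -- over X.
  refine ⟨ν, ?_, ?_⟩
  · have h := hasSum_sum hν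
    have h0 (n : ℕ) : ∑ l ∈ X, (w n l - if x n = l then 1 else 0) = 0 := by
      rw [Finset.sum_sub_distrib, hw1]
      simp [hx.1 n]
    simp_rw [h0] at h
    exact_mod_cast h.unique hasSum_zero
  · have h := hasSum_sum fun l hl => (Complex.hasSum_ofReal.mpr (hν l hl)).mul_right l
    have h0 (n : ℕ) : ∑ l ∈ X, ((w n l - if x n = l then 1 else 0 : ℝ) : ℂ) * l
        = diagonalSeq e A n - x n := by
      rw [hd]
      push_cast
      simp [sub_mul, Finset.sum_sub_distrib, apply_ite Complex.ofReal, hx.1 n]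
    simp_rw [h0] at h
    simpa using h.tsum_eq

end Diagonals

theorem theorem6p1 (P : Set ℂ) (X : Finset ℂ) (hP : IsConvexPolygon P X)
    (d : ℕ → ℂ) (hdP : ∀ n, d n ∈ P)
    (hd : Summable fun n => ‖∏ l ∈ X, (d n - l)‖) :
    ∃ hlim : d ∈ LimOne X,
      ∀ (H : Type*) [NormedAddCommGroup H] [InnerProductSpace ℂ H] [CompleteSpace H]
        (e : HilbertBasis ℕ ℂ H) (A : H →L[ℂ] H),
        A ∈ normalOperators H X → diagonalSeq e A = d →
          renormalizedSum X hP.nonempty ⟨d, hlim⟩ = 0 := by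
  refine ⟨hP.mem_limOne hdP hd, ?_⟩
  intro H _ _ _ e A ⟨hN, hA, _⟩ hdiag
  subst hdiag
  obtain ⟨x, hx⟩ := LimOne.exists_isApproximant hP.nonempty ⟨_, hP.mem_limOne hdP hd⟩
  rw [renormalizedSum_eq _ _ hx, QuotientAddGroup.eq_zero_iff]
  exact hP.tsum_diagonalSeq_sub_mem_obstructionSubgroup e A hA hx
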